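/- **Setting.** Compartments are identified by natural numbers; each has one procedure and private state. Events are cross-compartment calls $\mathsf{call}(C,D,z)$ (from $C$ to $D$ with argument $z\in\mathbb Z$) and returns $\mathsf{ret}(C,D,z)$ (from $C$ to $D$ with value $z$); in both, $C$ gives up control and $D$ gains it. A trace prefix is a finite list of events; $m|_C$ is the sublist of the events of $m$ that involve $C$. Fix disjoint finite sets $\mathit{Ctx}$ (context) and $\mathit{Prg}$ (program) of compartments and a main compartment in $\mathit{Ctx}\cup\mathit{Prg}$. A finite set $S$ of trace prefixes (given by a list, in any order) is *well-formed* if: 1. all events of all $m\in S$ are between compartments in $\mathit{Ctx}\cup\mathit{Prg}$; 2. each $m\in S$ is well-bracketed: the main compartment has control first, each event is emitted by the compartment that has control and passes control to its target, calls are between distinct compartments, and each return matches the topmost pending call; 3. context compartments are deterministic: if $C\in\mathit{Ctx}$, $m_1,m_2\in S$, $m_1|_C=h\,e_1\,t_1$ and $m_2|_C=h\,e_2\,t_2$, and $e_1$ is emitted by $C$, then $e_1=e_2$; 4. if $C\in\mathit{Ctx}$, $m_1,m_2\in S$, $m_1|_C=h\,\mathsf{call}(D_1,C,z)\,t_1$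 and $m_2|_C=h\,\mathsf{call}(D_2,C,z)\,t_2$, then $D_1=D_2$. The *source language* is a sequential expression language with integers, pointers, private compartment memory (a static buffer and dynamically allocated blocks), sequencing, conditionals, assignment, `exit` and procedure calls; it has a small-step semantics in which exactly the calls and returns between different compartments emit events (and carry integers). We write $W\rightsquigarrow_5 m$ if some finite execution of the whole program $W$, started in the procedure of the main compartment, emits exactly $m$. The *back-translation* $\uparrow_{D}(L)$ of a list $L$ of traces, for a finite set $D$ of compartments, generates each $C\in D$ by five passes: (a) merge the traces $m|_C$, $m\in L$, into a call-return tree with branches labeled by events, sharing common prefixes; (b) number the nodes in prefix order, from $0$, as unique locations; (c) annotate each node with its abstract call stack; (d) flatten the tree to the list of rules $(n,e,n')$, one for each edge from location $n$ to $n'$ labeled $e$; (e) generate the code of $C$, with private variables `loc` $=0$, `is_call` $=1$, `res` $=0$ initially. The code first updates `loc`: if `is_call` $\neq 0$, it sets `loc` to $n'$ for the first rule $(n,\mathsf{call}(\_,C,z),n')$ with `loc` $=n$ and argument $z$; otherwise, for the first rule $(n,\mathsf{ret}(\_,C,z),n')$ with `loc` $=n$ and `res` $=z$; without such a rule `loc`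 is unchanged. Then, for the first rule $(n,e,n')$ with `loc` $=n$ and $e$ emitted by $C$, it runs `is_call = 1; loc = n'; res = E(z); is_call = 0; C(0)` if $e=\mathsf{call}(C,E,z)$, or `is_call = 1; loc = n'; return z` if $e=\mathsf{ret}(C,E,z)$; without such a rule it exits. For $m\in S$, the source program for $m$ is $$\uparrow_{(a\text{-}e)}(S)_m \;=\; \uparrow_{\mathit{Ctx}}(S)\ \cup\ \uparrow_{\mathit{Prg}}([m]),$$ the linking of the context $\uparrow_{\mathit{Ctx}}(S)$, which is generated from all of $S$ and is the same for all $m$, with program compartments generated from $m$ alone. **Theorem (correctness of the call-return tree back-translation).** For every well-formed finite set $S$ of finite trace prefixes and every $m\in S$, $\uparrow_{(a\text{-}e)}(S)_m$ is a whole program (its main compartment and all compartments it calls are defined) and $$\uparrow_{(a\text{-}e)}(S)_m \rightsquigarrow_5 m .$$ In particular, if $\mathit{Prg}=\emptyset$, the single whole program $\uparrow_{\mathit{Ctx}}(S)$ can produce every $m\in S$. -/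

import Mathlib

namespace BackTranslation

/-! # Events and traces -/

/-- Compartment identifiers. A compartment consists of exactly one procedure and some private
state, so an identifier also names the procedure of the compartment. -/
abbrev Comp := ℕ

/-- Cross-compartment events: `call C D z` is a call from `C` to `D` with argument `z`;
`ret C D z` is a return from `C` to `D` with return value `z`. -/
inductive Event where
  | call (src dst : Comp) (z : ℤ)
  | ret (src dst : Comp) (z : ℤ)
  deriving DecidableEq

/-- The compartment that gives up control (it has control when the event is emitted). -/
def Event.src : Event → Comp
  | .call C _ _ => C
  | .ret C _ _ => C

/-- The compartment that gains control. -/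
def Event.dst : Event → Comp
  | .call _ D _ => D
  | .ret _ D _ => D

/-- Finite trace prefixes. -/
abbrev Trace := List Event

/-- Abstract cross-compartment call stacks, made of pairs (caller, callee); top first. -/
abbrev Stack := List (Comp × Comp)

/-- The events of a trace that involve the compartment `C`, in order: what `C` takes part in. -/
def proj (C : Comp) (m : Trace) : Trace :=
  m.filter fun e => decide (e.src = C ∨ e.dst = C)

/-- `WellBracketed C st m`: starting with `C` in control and with the call stack `st`, the trace
`m` passes control consistently, between distinct compartments, and every return matches the
topmost pending call. -/
def WellBracketed : Comp → Stack → Trace → Prop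
  | _, _, [] => True
  | cur, st, .call C D _ :: m => C = cur ∧ C ≠ D ∧ WellBracketed D ((C, D) :: st) m
  | cur, st, .ret C D _ :: m => C = cur ∧ ∃ st', st = (D, C) :: st' ∧ WellBracketed D st' m

/-- Well-formedness of a finite set `S` of trace prefixes, all starting with `main` in control, of
whole programs that share the context compartments `ctxt` and may differ in the way in which the
program compartments `prog` behave.

`det` says that context compartments are deterministic: if a context compartment has the same
history in two traces and has control, then two different events cannot appear at this point.
`input_det` says that, after the same history, two calls that a context compartment receives
with the same argument are the same event (a compartment that is called gets the argument, and
does not get the identity of its caller). -/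
structure WellFormed (ctxt prog : Finset Comp) (main : Comp) (S : List Trace) : Prop where
  compartments : ∀ m ∈ S, ∀ e ∈ m, e.src ∈ ctxt ∪ prog ∧ e.dst ∈ ctxt ∪ prog
  bracketed : ∀ m ∈ S, WellBracketed main [] m
  det : ∀ C ∈ ctxt, ∀ m₁ ∈ S, ∀ m₂ ∈ S, ∀ (h t₁ t₂ : Trace) (e₁ e₂ : Event),
    proj C m₁ = h ++ e₁ :: t₁ → proj C m₂ = h ++ e₂ :: t₂ → e₁.src = C → e₁ = e₂
  input_det : ∀ C ∈ ctxt, ∀ m₁ ∈ S, ∀ m₂ ∈ S, ∀ (h t₁ t₂ : Trace) (D₁ D₂ : Comp) (z : ℤ),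
    proj C m₁ = h ++ .call D₁ C z :: t₁ → proj C m₂ = h ++ .call D₂ C z :: t₂ → D₁ = D₂

/-! # The source language -/

/-- Values: integers, pointers (compartment, block, offset), and the undefined value. -/
inductive Value where
  | int (z : ℤ)
  | ptr (C : Comp) (block : ℕ) (offset : ℤ)
  | undef

inductive Binop where
  | add | sub | mul | eq | leq

/-- Expressions of the source language. The value of the body of a procedure is its return
value. `localBuf` is a pointer to the private static buffer of the running compartment. -/
inductive Expr where
  | val (v : Value)
  | arg
  | localBuf
  | binop (op : Binop) (e₁ e₂ : Expr)
  | seq (e₁ e₂ : Expr)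
  | ite (e e₁ e₂ : Expr)
  | alloc (e : Expr)
  | deref (e : Expr)
  | assign (addr e : Expr)
  | call (C : Comp) (e : Expr)
  | exit

/-- The compartments whose procedure is called in an expression. -/
def Expr.callees : Expr → Set Comp
  | .val _ => ∅
  | .arg => ∅
  | .localBuf => ∅
  | .binop _ e₁ e₂ => e₁.callees ∪ e₂.callees
  | .seq e₁ e₂ => e₁.callees ∪ e₂.callees
  | .ite e e₁ e₂ => e.callees ∪ e₁.callees ∪ e₂.callees
  | .alloc e => e.callees
  | .deref e => e.callees
  | .assign e₁ e₂ => e₁.callees ∪ e₂.callees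
  | .call C e => {C} ∪ e.callees
  | .exit => ∅

/-- A compartment: the body of its procedure, and the initial contents of its static buffer. -/
structure Compartment where
  body : Expr
  buffer : List Value

/-- A (possibly partial) source program: a finite set of compartments. -/
structure Program where
  code : Comp → Option Compartment
  finite_dom : {C | code C ≠ none}.Finite

/-- Linking of two programs (used for programs that define disjoint sets of compartments). -/
def Program.link (p q : Program) : Program where
  code C := (p.code C).or (q.code C)
  finite_dom := (p.finite_dom.union q.finite_dom).subset fun C hC => by
    by_cases h : p.code C = none
    · right; simpa [h] using hC
    · left; exact h

/-- A whole program: its main compartment is defined, and all calls are to defined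
compartments. -/
def Program.IsWhole (p : Program) (main : Comp) : Prop :=
  p.code main ≠ none ∧
    ∀ C d, p.code C = some d → ∀ D ∈ d.body.callees, p.code D ≠ none

/-- The memory of a compartment is its list of blocks; block `0` is the static buffer. -/
abbrev Memory := Comp → List (List Value)

def Memory.load (mem : Memory) (C : Comp) (b : ℕ) (o : ℤ) : Option Value :=
  if 0 ≤ o then (mem C)[b]?.bind fun buf => buf[o.toNat]? else none

def Memory.store (mem : Memory) (C : Comp) (b : ℕ) (o : ℤ) (v : Value) : Option Memory :=
  match (mem C)[b]? with
  | some buf =>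
    if 0 ≤ o ∧ o.toNat < buf.length then
      some (Function.update mem C ((mem C).set b (buf.set o.toNat v)))
    else none
  | none => none

/-- Append a fresh block of `n` cells; its index is the former number of blocks. -/
def Memory.alloc (mem : Memory) (C : Comp) (n : ℕ) : Memory :=
  Function.update mem C (mem C ++ [List.replicate n .undef])

def Program.initMem (p : Program) : Memory := fun C =>
  match p.code C with
  | some d => [d.buffer]
  | none => []

def Binop.eval : Binop → Value → Value → Value
  | .add, .int a, .int b => .int (a + b)
  | .add, .ptr C b o, .int i => .ptr C b (o + i)
  | .add, .int i, .ptr C b o => .ptr C b (o + i)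
  | .sub, .int a, .int b => .int (a - b)
  | .sub, .ptr C b o, .int i => .ptr C b (o - i)
  | .sub, .ptr C b o, .ptr C' b' o' => if C = C' ∧ b = b' then .int (o - o') else .undef
  | .mul, .int a, .int b => .int (a * b)
  | .eq, .int a, .int b => .int (if a = b then 1 else 0)
  | .eq, .ptr C b o, .ptr C' b' o' => .int (if C = C' ∧ b = b' ∧ o = o' then 1 else 0)
  | .leq, .int a, .int b => .int (if a ≤ b then 1 else 0)
  | .leq, .ptr C b o, .ptr C' b' o' =>
    if C = C' ∧ b = b' then .int (if o ≤ o' then 1 else 0) else .undef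
  | _, _, _ => .undef

/-- Continuations: what remains to be done in the running procedure. -/
inductive Cont where
  | halt
  | binop₁ (op : Binop) (e₂ : Expr) (k : Cont)
  | binop₂ (op : Binop) (v₁ : Value) (k : Cont)
  | seq (e₂ : Expr) (k : Cont)
  | ite (e₁ e₂ : Expr) (k : Cont)
  | alloc (k : Cont)
  | deref (k : Cont)
  | assign₁ (addr : Expr) (k : Cont)
  | assign₂ (v : Value) (k : Cont)
  | call (C : Comp) (k : Cont)

/-- Frames of the concrete call stack. -/
structure Frame where
  comp : Comp
  arg : Value
  cont : Cont

/-- States: running compartment, call stack, memory, continuation, expression under evaluation,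
and argument of the running procedure. -/
structure State where
  comp : Comp
  stack : List Frame
  mem : Memory
  cont : Cont
  expr : Expr
  arg : Value

/-- Small-step semantics. Calls and returns inside a compartment are silent; those between two
different compartments emit an event and carry integers. States without a rule are final or
undefined behavior. -/
inductive Step (p : Program) : State → Trace → State → Prop where
  | arg {C s mem k a} : Step p ⟨C, s, mem, k, .arg, a⟩ [] ⟨C, s, mem, k, .val a, a⟩
  | localBuf {C s mem k a} :
      Step p ⟨C, s, mem, k, .localBuf, a⟩ [] ⟨C, s, mem, k, .val (.ptr C 0 0), a⟩
  | binop₁ {C s mem k a op e₁ e₂} :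
      Step p ⟨C, s, mem, k, .binop op e₁ e₂, a⟩ [] ⟨C, s, mem, .binop₁ op e₂ k, e₁, a⟩
  | binop₂ {C s mem k a op v₁ e₂} :
      Step p ⟨C, s, mem, .binop₁ op e₂ k, .val v₁, a⟩ [] ⟨C, s, mem, .binop₂ op v₁ k, e₂, a⟩
  | binop₃ {C s mem k a op v₁ v₂} :
      Step p ⟨C, s, mem, .binop₂ op v₁ k, .val v₂, a⟩ []
        ⟨C, s, mem, k, .val (op.eval v₁ v₂), a⟩
  | seq₁ {C s mem k a e₁ e₂} :
      Step p ⟨C, s, mem, k, .seq e₁ e₂, a⟩ [] ⟨C, s, mem, .seq e₂ k, e₁, a⟩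
  | seq₂ {C s mem k a v e₂} :
      Step p ⟨C, s, mem, .seq e₂ k, .val v, a⟩ [] ⟨C, s, mem, k, e₂, a⟩
  | ite₁ {C s mem k a e e₁ e₂} :
      Step p ⟨C, s, mem, k, .ite e e₁ e₂, a⟩ [] ⟨C, s, mem, .ite e₁ e₂ k, e, a⟩
  | ite₂ {C s mem k a i e₁ e₂} :
      Step p ⟨C, s, mem, .ite e₁ e₂ k, .val (.int i), a⟩ []
        ⟨C, s, mem, k, if i ≠ 0 then e₁ else e₂, a⟩
  | alloc₁ {C s mem k a e} :
      Step p ⟨C, s, mem, k, .alloc e, a⟩ [] ⟨C, s, mem, .alloc k, e, a⟩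
  | alloc₂ {C s mem k a} {n : ℤ} (hn : 0 < n) :
      Step p ⟨C, s, mem, .alloc k, .val (.int n), a⟩ []
        ⟨C, s, Memory.alloc mem C n.toNat, k, .val (.ptr C (mem C).length 0), a⟩
  | deref₁ {C s mem k a e} :
      Step p ⟨C, s, mem, k, .deref e, a⟩ [] ⟨C, s, mem, .deref k, e, a⟩
  | deref₂ {C s mem k a b o v} (h : Memory.load mem C b o = some v) :
      Step p ⟨C, s, mem, .deref k, .val (.ptr C b o), a⟩ [] ⟨C, s, mem, k, .val v, a⟩
  | assign₁ {C s mem k a addr e} :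
      Step p ⟨C, s, mem, k, .assign addr e, a⟩ [] ⟨C, s, mem, .assign₁ addr k, e, a⟩
  | assign₂ {C s mem k a addr v} :
      Step p ⟨C, s, mem, .assign₁ addr k, .val v, a⟩ [] ⟨C, s, mem, .assign₂ v k, addr, a⟩
  | assign₃ {C s mem mem' k a b o v} (h : Memory.store mem C b o v = some mem') :
      Step p ⟨C, s, mem, .assign₂ v k, .val (.ptr C b o), a⟩ [] ⟨C, s, mem', k, .val v, a⟩
  | call {C s mem k a D e} :
      Step p ⟨C, s, mem, k, .call D e, a⟩ [] ⟨C, s, mem, .call D k, e, a⟩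
  | internalCall {C s mem k a v d} (hd : p.code C = some d) :
      Step p ⟨C, s, mem, .call C k, .val v, a⟩ [] ⟨C, ⟨C, a, k⟩ :: s, mem, .halt, d.body, v⟩
  | externalCall {C s mem k a D z d} (hne : C ≠ D) (hd : p.code D = some d) :
      Step p ⟨C, s, mem, .call D k, .val (.int z), a⟩ [.call C D z]
        ⟨D, ⟨C, a, k⟩ :: s, mem, .halt, d.body, .int z⟩
  | internalReturn {C s mem k a a' v} :
      Step p ⟨C, ⟨C, a', k⟩ :: s, mem, .halt, .val v, a⟩ [] ⟨C, s, mem, k, .val v, a'⟩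
  | externalReturn {C D s mem k a a' z} (hne : C ≠ D) :
      Step p ⟨C, ⟨D, a', k⟩ :: s, mem, .halt, .val (.int z), a⟩ [.ret C D z]
        ⟨D, s, mem, k, .val (.int z), a'⟩

/-- Finite executions, with the concatenation of the events emitted. -/
inductive Steps (p : Program) : State → Trace → State → Prop where
  | refl (s : State) : Steps p s [] s
  | step {s s' s'' : State} {t t' : Trace} :
      Step p s t s' → Steps p s' t' s'' → Steps p s (t ++ t') s''

/-- Initial states: the procedure of the main compartment is about to run (on argument `0`). -/
inductive Initial (p : Program) (main : Comp) : State → Prop where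
  | intro {d : Compartment} (hd : p.code main = some d) :
      Initial p main ⟨main, [], p.initMem, .halt, d.body, .int 0⟩

/-- `Produces p main m`: some finite execution from an initial state emits exactly `m`, that is,
`p` can produce the finite trace prefix `m`. -/
def Produces (p : Program) (main : Comp) (m : Trace) : Prop :=
  ∃ s s', Initial p main s ∧ Steps p s m s'

/-! # Pass (a): from traces to call-return trees -/

/-! Trees with node contents in `A` and branches labeled by events. -/
mutual
inductive EvTree (A : Type) where
  | node (a : A) (br : Branches A) : EvTree A
inductive Branches (A : Type) where
  | nil : Branches A
  | cons (e : Event) (t : EvTree A) (br : Branches A) : Branches A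
end

/-- Apply `f` to the subtree at the branch labeled `e`; if there is no such branch, add one, with
the result of applying `f` to a leaf. -/
def Branches.modify (e : Event) (f : EvTree Unit → EvTree Unit) : Branches Unit → Branches Unit
  | .nil => .cons e (f (.node () .nil)) .nil
  | .cons e' t br => if e = e' then .cons e' (f t) br else .cons e' t (br.modify e f)

/-- Add a trace to a tree, sharing the longest prefix that is already there. -/
def addTrace : Trace → EvTree Unit → EvTree Unit
  | [], t => t
  | e :: m, .node _ br => .node () (br.modify e (addTrace m))

def treeOfTraces (L : List Trace) : EvTree Unit :=
  L.foldl (fun t m => addTrace m t) (.node () .nil)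

/-- The call-return tree of the compartment `C` for the set of traces `S`. -/
def passA (C : Comp) (S : List Trace) : EvTree Unit :=
  treeOfTraces (S.map (proj C))

/-! # Pass (b): unique location identifiers -/

/-! Number the nodes in prefix order from `k` on; also return the next unused number. -/
mutual
def EvTree.number : ℕ → EvTree Unit → EvTree ℕ × ℕ
  | k, .node _ br => (.node k (br.number (k + 1)).1, (br.number (k + 1)).2)
def Branches.number : ℕ → Branches Unit → Branches ℕ × ℕ
  | k, .nil => (.nil, k)
  | k, .cons e t br =>
    (.cons e (t.number k).1 (br.number (t.number k).2).1, (br.number (t.number k).2).2)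
end

def passB (t : EvTree Unit) : EvTree ℕ := (t.number 0).1

/-! # Pass (c): stack snapshots -/

/-- The effect of an event on the abstract stack. -/
def Event.onStack : Event → Stack → Stack
  | .call C D _, st => (C, D) :: st
  | .ret _ _ _, st => st.tail

mutual
def EvTree.addStack : Stack → EvTree ℕ → EvTree (ℕ × Stack)
  | st, .node n br => .node (n, st) (br.addStack st)
def Branches.addStack : Stack → Branches ℕ → Branches (ℕ × Stack)
  | _, .nil => .nil
  | st, .cons e t br => .cons e (t.addStack (e.onStack st)) (br.addStack st)
end

def passC (t : EvTree ℕ) : EvTree (ℕ × Stack) := t.addStack []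

/-! # Pass (d): flattening -/

/-- The rule `(n, e, n')`: at location `n`, emit or receive `e` and move to location `n'`. -/
abbrev Rule := ℕ × Event × ℕ

def EvTree.loc : EvTree (ℕ × Stack) → ℕ
  | .node a _ => a.1

mutual
def EvTree.rules : EvTree (ℕ × Stack) → List Rule
  | .node a br => br.rules a.1
def Branches.rules : ℕ → Branches (ℕ × Stack) → List Rule
  | _, .nil => []
  | n, .cons e t br => (n, e, t.loc) :: (t.rules ++ br.rules n)
end

def passD (t : EvTree (ℕ × Stack)) : List Rule := t.rules

/-! # Pass (e): code generation -/

def intE (z : ℤ) : Expr := .val (.int z)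

/-- Address of the private variable number `i`: `0` is `loc`, `1` is `is_call`, `2` is `res`. -/
def varAddr (i : ℤ) : Expr := .binop .add .localBuf (intE i)

def getVar (i : ℤ) : Expr := .deref (varAddr i)

def setVar (i : ℤ) (e : Expr) : Expr := .assign (varAddr i) e

/-- Update the location on receiving an incoming call. -/
def switchCalls (C : Comp) (rs : List Rule) : Expr :=
  rs.foldr (fun r acc => match r with
    | (n, .call _ D z, n') =>
      if D = C then
        .ite (.binop .mul (.binop .eq (getVar 0) (intE n)) (.binop .eq .arg (intE z)))
          (setVar 0 (intE n')) acc
      else acc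
    | _ => acc) (intE 0)

/-- Update the location on receiving a return value, which is stored in `res`. -/
def switchReturns (C : Comp) (rs : List Rule) : Expr :=
  rs.foldr (fun r acc => match r with
    | (n, .ret _ D z, n') =>
      if D = C then
        .ite (.binop .mul (.binop .eq (getVar 0) (intE n)) (.binop .eq (getVar 2) (intE z)))
          (setVar 0 (intE n')) acc
      else acc
    | _ => acc) (intE 0)

/-- The statement that produces an outgoing event of `C` and moves to location `n'`. For a call:
`is_call = 1; loc = n'; res = D(z); is_call = 0; C()`; for a return:
`is_call = 1; loc = n'; return z`. -/
def emit (C : Comp) (n' : ℕ) : Event → Expr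
  | .call _ D z =>
    .seq (setVar 1 (intE 1)) (.seq (setVar 0 (intE n'))
      (.seq (setVar 2 (.call D (intE z))) (.seq (setVar 1 (intE 0)) (.call C (intE 0)))))
  | .ret _ _ z => .seq (setVar 1 (intE 1)) (.seq (setVar 0 (intE n')) (intE z))

/-- Produce the event prescribed by the current location, if any. -/
def switchOutgoing (C : Comp) (rs : List Rule) : Expr :=
  rs.foldr (fun r acc =>
    if r.2.1.src = C then
      .ite (.binop .eq (getVar 0) (intE r.1)) (emit C r.2.2 r.2.1) acc
    else acc) .exit

/-- The source compartment generated from the rules of `C`. Initially `loc = 0`, `is_call = 1`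
and `res = 0`. -/
def passE (C : Comp) (rs : List Rule) : Compartment where
  body := .seq (.ite (getVar 1) (switchCalls C rs) (switchReturns C rs)) (switchOutgoing C rs)
  buffer := [.int 0, .int 1, .int 0]

/-! # The whole back-translation -/

/-- The back-translation (a)-(e) of the set of traces `S`, for the compartments in `dom`. -/
def backTranslate (dom : Finset Comp) (S : List Trace) : Program where
  code C := if C ∈ dom then some (passE C (passD (passC (passB (passA C S))))) else none
  finite_dom := dom.finite_toSet.subset fun C hC => by
    by_contra h
    exact hC (if_neg h)

/-- The source whole program for the trace `m` of `S`: the context compartments are generated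
from the entire set `S` (and so do not depend on `m`); the program compartments are generated
from `m` only. -/
def backTranslateWhole (ctxt prog : Finset Comp) (S : List Trace) (m : Trace) : Program :=
  (backTranslate ctxt S).link (backTranslate prog [m])

end BackTranslation

open BackTranslation

-- Each generated compartment runs an automaton whose states are its local histories. The merged
-- tree of `C` has one node for each prefix of a projection `proj C m` (`hasNode_treeOfTraces`), and
-- the numbering of nodes is injective, so `loc` encodes exactly what `C` has taken part in so far.
-- The rules are the edges of the tree.
--
-- Along a trace of the list, the edge for the next event exists at the current location. What has
-- to be excluded is that the code, which takes the first applicable rule, takes a different edge;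
-- this is `LocallyDeterministic.follows`. For an emitted event it is determinism. For a received
-- call it is input determinism, because the code sees the argument but not the caller. For a
-- received return it follows from bracketing: the history determines the pending call, hence who
-- returns. A compartment generated from a single trace has no competing continuations at all.
--
-- The execution is built by induction on the remaining trace (`steps_trace`). The invariant holds
-- whenever the compartment in control is about to select an outgoing event: every `loc` is the
-- number of the local history and every compartment without control has `is_call = 1` (`MemMatch`),
-- while the concrete stack is the abstract one with extra frames (`StackMatch`). These frames
-- appear because a compartment continues after a return by calling itself; nothing is left to do in
-- them, so they unwind silently when it returns. The start of the run looks like a call with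
-- argument `0`, which is harmless because the main compartment has no call rule at location `0`.

namespace BackTranslation

/-! # Paths in trees -/

/-! `HasNode h a`: following the labels `h` from the root, one can reach a node with contents `a`. -/
mutual
def EvTree.HasNode {A : Type} : EvTree A → Trace → A → Prop
  | .node a _, [], x => x = a
  | .node _ br, e :: h, x => br.HasNode e h x
def Branches.HasNode {A : Type} : Branches A → Event → Trace → A → Prop
  | .nil, _, _, _ => False
  | .cons e' t br, e, h, x => (e = e' ∧ t.HasNode h x) ∨ br.HasNode e h x
end

/-! The branches of every node have distinct labels. -/
mutual
def EvTree.Distinct {A : Type} : EvTree A → Prop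
  | .node _ br => br.Distinct
def Branches.Distinct {A : Type} : Branches A → Prop
  | .nil => True
  | .cons e t br => (∀ h x, ¬ br.HasNode e h x) ∧ t.Distinct ∧ br.Distinct
end

-- At each node at most one branch carries the next label, so a history leads to at most one node.
-- This is what makes "the location of a history" well defined.
mutual
theorem EvTree.HasNode.unique {A : Type} : ∀ (t : EvTree A), t.Distinct → ∀ {h : Trace} {x y : A},
    t.HasNode h x → t.HasNode h y → x = y
  | .node a br, _, [], x, y, hx, hy => by
    simp only [EvTree.HasNode] at hx hy
    rw [hx, hy]
  | .node a br, hd, e :: h, x, y, hx, hy => by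
    simp only [EvTree.HasNode, EvTree.Distinct] at hx hy hd
    exact Branches.HasNode.unique br hd hx hy
theorem Branches.HasNode.unique {A : Type} : ∀ (br : Branches A), br.Distinct →
    ∀ {e : Event} {h : Trace} {x y : A}, br.HasNode e h x → br.HasNode e h y → x = y
  | .nil, _, _, _, _, _, hx, _ => by simp [Branches.HasNode] at hx
  | .cons e' t br, hd, e, h, x, y, hx, hy => by
    simp only [Branches.HasNode, Branches.Distinct] at hx hy hd
    obtain ⟨h1, h2, h3⟩ := hd
    rcases hx with ⟨rfl, hx⟩ | hx <;> rcases hy with ⟨he, hy⟩ | hy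
    · exact EvTree.HasNode.unique t h2 hx hy
    · exact absurd hy (h1 _ _)
    · subst he
      exact absurd hx (h1 _ _)
    · exact Branches.HasNode.unique br h3 hx hy
end

/-! # Merging traces -/

/-- Stated for an abstract `f` that adds the paths in `P`, so that the induction over branches is
separate from the recursion of `addTrace`, where `P` is `(· <+: m)`. A new branch starts from a
leaf, which already has the empty path; `P []` absorbs it. -/
theorem Branches.hasNode_modify (e : Event) (f : EvTree Unit → EvTree Unit) (P : Trace → Prop)
    (hP : P []) (hf : ∀ t h, (f t).HasNode h () ↔ t.HasNode h () ∨ P h) :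
    ∀ (br : Branches Unit) (e' : Event) (h : Trace),
      (br.modify e f).HasNode e' h () ↔ br.HasNode e' h () ∨ (e' = e ∧ P h)
  | .nil, e', h => by
    have : (EvTree.node () Branches.nil).HasNode h () ↔ h = [] := by
      cases h <;> simp [EvTree.HasNode, Branches.HasNode]
    simp only [Branches.modify, Branches.HasNode, hf, this]
    grind
  | .cons e₁ t br, e', h => by
    have ih := Branches.hasNode_modify e f P hP hf br e' h
    by_cases hc : e = e₁
    · simp only [Branches.modify, if_pos hc, Branches.HasNode, hf]
      grind
    · simp only [Branches.modify, if_neg hc, Branches.HasNode, ih]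
      grind

theorem EvTree.hasNode_addTrace : ∀ (m : Trace) (t : EvTree Unit) (h : Trace),
    (addTrace m t).HasNode h () ↔ t.HasNode h () ∨ h <+: m
  | [], t, h => by
    cases t
    cases h <;> simp [addTrace, EvTree.HasNode]
  | e :: m, .node a br, h => by
    cases h with
    | nil => simp [addTrace, EvTree.HasNode]
    | cons e' h =>
      simp only [addTrace, EvTree.HasNode, List.cons_prefix_cons]
      exact Branches.hasNode_modify e (addTrace m) (· <+: m) List.nil_prefix
        (fun t h => EvTree.hasNode_addTrace m t h) br e' h

/-- The search passes a branch only if its label differs from `e`, and every path it adds beyond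
that branch starts with `e`, so no clash is created. -/
theorem Branches.distinct_modify (e : Event) (f : EvTree Unit → EvTree Unit) (P : Trace → Prop)
    (hP : P []) (hf : ∀ t h, (f t).HasNode h () ↔ t.HasNode h () ∨ P h)
    (hd : ∀ t : EvTree Unit, t.Distinct → (f t).Distinct) :
    ∀ br : Branches Unit, br.Distinct → (br.modify e f).Distinct
  | .nil, _ => by
    simp only [Branches.modify, Branches.Distinct, Branches.HasNode]
    exact ⟨by simp, hd _ (by simp [EvTree.Distinct, Branches.Distinct]), trivial⟩
  | .cons e₁ t br, h => by
    simp only [Branches.Distinct] at h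
    by_cases hc : e = e₁
    · simp only [Branches.modify, if_pos hc, Branches.Distinct]
      exact ⟨h.1, hd _ h.2.1, h.2.2⟩
    · simp only [Branches.modify, if_neg hc, Branches.Distinct]
      refine ⟨fun h' x hx => ?_, h.2.1, Branches.distinct_modify e f P hP hf hd br h.2.2⟩
      rcases (Branches.hasNode_modify e f P hP hf br e₁ h').1 hx with h'' | ⟨h'', -⟩
      · exact h.1 _ _ h''
      · exact hc h''.symm

theorem EvTree.distinct_addTrace : ∀ (m : Trace) (t : EvTree Unit), t.Distinct →
    (addTrace m t).Distinct
  | [], t, h => by simpa [addTrace] using h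
  | e :: m, .node a br, h => by
    simp only [addTrace, EvTree.Distinct] at h ⊢
    exact Branches.distinct_modify e (addTrace m) (· <+: m) List.nil_prefix
        (fun t h => EvTree.hasNode_addTrace m t h) (EvTree.distinct_addTrace m) br h

theorem hasNode_foldl_addTrace (L : List Trace) (t : EvTree Unit) (h : Trace) :
    (L.foldl (fun t m => addTrace m t) t).HasNode h () ↔
      t.HasNode h () ∨ ∃ m ∈ L, h <+: m := by
  induction L generalizing t with
  | nil => simp
  | cons m L ih => simp [ih, EvTree.hasNode_addTrace, or_assoc]

theorem distinct_foldl_addTrace (L : List Trace) (t : EvTree Unit) (ht : t.Distinct) :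
    (L.foldl (fun t m => addTrace m t) t).Distinct := by
  induction L generalizing t with
  | nil => exact ht
  | cons m L ih => exact ih _ (EvTree.distinct_addTrace m t ht)

theorem hasNode_treeOfTraces (L : List Trace) (h : Trace) :
    (treeOfTraces L).HasNode h () ↔ h = [] ∨ ∃ m ∈ L, h <+: m := by
  rw [treeOfTraces, hasNode_foldl_addTrace]
  cases h <;> simp [EvTree.HasNode, Branches.HasNode]

theorem distinct_treeOfTraces (L : List Trace) : (treeOfTraces L).Distinct :=
  distinct_foldl_addTrace L _ (by simp [EvTree.Distinct, Branches.Distinct])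

/-! # Numbering -/

-- Numbering keeps the shape of the tree; only the contents change.
mutual
theorem EvTree.hasNode_number : ∀ (t : EvTree Unit) (k : ℕ) (h : Trace),
    (∃ n, (t.number k).1.HasNode h n) ↔ t.HasNode h ()
  | .node a br, k, [] => by simp [EvTree.number, EvTree.HasNode]
  | .node a br, k, e :: h => by
    simpa only [EvTree.number, EvTree.HasNode] using Branches.hasNode_number br (k + 1) e h
theorem Branches.hasNode_number : ∀ (br : Branches Unit) (k : ℕ) (e : Event) (h : Trace),
    (∃ n, (br.number k).1.HasNode e h n) ↔ br.HasNode e h ()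
  | .nil, k, e, h => by simp [Branches.number, Branches.HasNode]
  | .cons e' t br, k, e, h => by
    simp only [Branches.number, Branches.HasNode, exists_or, exists_and_left,
      EvTree.hasNode_number t, Branches.hasNode_number br]
end

mutual
theorem EvTree.distinct_number : ∀ (t : EvTree Unit) (k : ℕ), t.Distinct →
    (t.number k).1.Distinct
  | .node a br, k, h => by
    simp only [EvTree.number, EvTree.Distinct] at h ⊢
    exact Branches.distinct_number br _ h
theorem Branches.distinct_number : ∀ (br : Branches Unit) (k : ℕ), br.Distinct →
    (br.number k).1.Distinct
  | .nil, k, h => by simp [Branches.number, Branches.Distinct]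
  | .cons e t br, k, h => by
    simp only [Branches.number, Branches.Distinct] at h ⊢
    exact ⟨fun h' x hx => h.1 h' () ((Branches.hasNode_number br _ e h').1 ⟨x, hx⟩),
      EvTree.distinct_number t _ h.2.1, Branches.distinct_number br _ h.2.2⟩
end

mutual
theorem EvTree.number_lt : ∀ (t : EvTree Unit) (k : ℕ), k < (t.number k).2
  | .node a br, k => by
    simp only [EvTree.number]
    have := Branches.number_le br (k + 1)
    omega
theorem Branches.number_le : ∀ (br : Branches Unit) (k : ℕ), k ≤ (br.number k).2
  | .nil, k => by simp [Branches.number]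
  | .cons e t br, k => by
    simp only [Branches.number]
    have := EvTree.number_lt t k
    have := Branches.number_le br (t.number k).2
    omega
end

-- In prefix order a subtree uses an interval of numbers, from its start value up to but excluding
-- the returned counter. Siblings thus use disjoint intervals, which gives the injectivity below.
mutual
theorem EvTree.number_bounds : ∀ (t : EvTree Unit) (k : ℕ) (h : Trace) (n : ℕ),
    (t.number k).1.HasNode h n → k ≤ n ∧ n < (t.number k).2
  | .node a br, k, [], n, hn => by
    simp only [EvTree.number, EvTree.HasNode] at hn ⊢
    have := Branches.number_le br (k + 1)
    omega
  | .node a br, k, e :: h, n, hn => by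
    simp only [EvTree.number, EvTree.HasNode] at hn ⊢
    have := Branches.number_bounds br (k + 1) e h n hn
    omega
theorem Branches.number_bounds : ∀ (br : Branches Unit) (k : ℕ) (e : Event) (h : Trace) (n : ℕ),
    (br.number k).1.HasNode e h n → k ≤ n ∧ n < (br.number k).2
  | .nil, k, e, h, n, hn => by simp [Branches.number, Branches.HasNode] at hn
  | .cons e' t br, k, e, h, n, hn => by
    simp only [Branches.number, Branches.HasNode] at hn ⊢
    have := EvTree.number_lt t k
    have := Branches.number_le br (t.number k).2
    rcases hn with ⟨-, hn⟩ | hn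
    · have := EvTree.number_bounds t k h n hn
      omega
    · have := Branches.number_bounds br _ e h n hn
      omega
end

mutual
theorem EvTree.number_injective : ∀ (t : EvTree Unit) (k : ℕ) (h h' : Trace) (n : ℕ),
    (t.number k).1.HasNode h n → (t.number k).1.HasNode h' n → h = h'
  | .node a br, k, [], [], n, _, _ => rfl
  | .node a br, k, [], e :: h, n, hn, hn' => by
    simp only [EvTree.number, EvTree.HasNode] at hn hn'
    have := Branches.number_bounds br (k + 1) e h n hn'
    omega
  | .node a br, k, e :: h, [], n, hn, hn' => by
    simp only [EvTree.number, EvTree.HasNode] at hn hn'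
    have := Branches.number_bounds br (k + 1) e h n hn
    omega
  | .node a br, k, e :: h, e' :: h', n, hn, hn' => by
    simp only [EvTree.number, EvTree.HasNode] at hn hn'
    obtain ⟨rfl, rfl⟩ := Branches.number_injective br (k + 1) e e' h h' n hn hn'
    rfl
theorem Branches.number_injective : ∀ (br : Branches Unit) (k : ℕ) (e e' : Event) (h h' : Trace)
    (n : ℕ), (br.number k).1.HasNode e h n → (br.number k).1.HasNode e' h' n → e = e' ∧ h = h'
  | .nil, k, e, e', h, h', n, hn, _ => by simp [Branches.number, Branches.HasNode] at hn
  | .cons e₁ t br, k, e, e', h, h', n, hn, hn' => by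
    simp only [Branches.number, Branches.HasNode] at hn hn'
    rcases hn with ⟨rfl, hn⟩ | hn <;> rcases hn' with ⟨he, hn'⟩ | hn'
    · exact ⟨he.symm, EvTree.number_injective t k h h' n hn hn'⟩
    · have := EvTree.number_bounds t k h n hn
      have := Branches.number_bounds br _ e' h' n hn'
      omega
    · have := EvTree.number_bounds t k h' n hn'
      have := Branches.number_bounds br _ e h n hn
      omega
    · exact Branches.number_injective br _ e e' h h' n hn hn'
end

/-! # Stack annotations and rules -/

-- The stack snapshots do not affect the shape or the numbers, and the rules ignore them; the
-- existential over `s` discards them.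
mutual
theorem EvTree.hasNode_addStack : ∀ (t : EvTree ℕ) (st : Stack) (h : Trace) (n : ℕ),
    (∃ s, (t.addStack st).HasNode h (n, s)) ↔ t.HasNode h n
  | .node a br, st, [], n => by simp [EvTree.addStack, EvTree.HasNode]
  | .node a br, st, e :: h, n => by
    simpa only [EvTree.addStack, EvTree.HasNode] using Branches.hasNode_addStack br st e h n
theorem Branches.hasNode_addStack : ∀ (br : Branches ℕ) (st : Stack) (e : Event) (h : Trace)
    (n : ℕ), (∃ s, (br.addStack st).HasNode e h (n, s)) ↔ br.HasNode e h n
  | .nil, st, e, h, n => by simp [Branches.addStack, Branches.HasNode]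
  | .cons e' t br, st, e, h, n => by
    simp only [Branches.addStack, Branches.HasNode, exists_or, exists_and_left,
      EvTree.hasNode_addStack t, Branches.hasNode_addStack br]
end

theorem EvTree.hasNode_nil (t : EvTree (ℕ × Stack)) : ∃ s, t.HasNode [] (t.loc, s) := by
  cases t
  simp [EvTree.HasNode, EvTree.loc]

-- Together with its converse below: the rules are exactly the edges of the tree. For branches, the
-- source of an edge may be the parent, whose number is only available as the parameter `k`; hence
-- the two cases.
mutual
theorem EvTree.hasNode_of_mem_rules : ∀ (t : EvTree (ℕ × Stack)) {n n' : ℕ} {e : Event},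
    (n, e, n') ∈ t.rules → ∃ h s s', t.HasNode h (n, s) ∧ t.HasNode (h ++ [e]) (n', s')
  | .node a br, n, n', e, hr => by
    simp only [EvTree.rules] at hr
    rcases Branches.hasNode_of_mem_rules br hr with ⟨rfl, s', h⟩ | ⟨e₁, h, s, s', h1, h2⟩
    · exact ⟨[], a.2, s', by simp [EvTree.HasNode], by simpa [EvTree.HasNode] using h⟩
    · exact ⟨e₁ :: h, s, s', by simpa [EvTree.HasNode] using h1,
        by simpa [EvTree.HasNode] using h2⟩
theorem Branches.hasNode_of_mem_rules : ∀ (br : Branches (ℕ × Stack)) {k n n' : ℕ} {e : Event},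
    (n, e, n') ∈ br.rules k → (n = k ∧ ∃ s', br.HasNode e [] (n', s')) ∨
      ∃ e₁ h s s', br.HasNode e₁ h (n, s) ∧ br.HasNode e₁ (h ++ [e]) (n', s')
  | .nil, k, n, n', e, hr => by simp [Branches.rules] at hr
  | .cons e' t br, k, n, n', e, hr => by
    simp only [Branches.rules, List.mem_cons, List.mem_append, Prod.mk.injEq] at hr
    rcases hr with ⟨rfl, rfl, rfl⟩ | hr | hr
    · obtain ⟨s, hs⟩ := t.hasNode_nil
      exact Or.inl ⟨rfl, s, by simp [Branches.HasNode, hs]⟩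
    · obtain ⟨h, s, s', h1, h2⟩ := EvTree.hasNode_of_mem_rules t hr
      exact Or.inr ⟨e', h, s, s', by simp [Branches.HasNode, h1], by simp [Branches.HasNode, h2]⟩
    · rcases Branches.hasNode_of_mem_rules br hr with ⟨rfl, s', h⟩ | ⟨e₁, h, s, s', h1, h2⟩
      · exact Or.inl ⟨rfl, s', by simp [Branches.HasNode, h]⟩
      · exact Or.inr ⟨e₁, h, s, s', by simp [Branches.HasNode, h1],
          by simp [Branches.HasNode, h2]⟩
end

mutual
theorem EvTree.mem_rules_of_hasNode : ∀ (t : EvTree (ℕ × Stack)) {h : Trace} {e : Event}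
    {n' : ℕ} {s' : Stack}, t.HasNode (h ++ [e]) (n', s') →
      ∃ n s, t.HasNode h (n, s) ∧ (n, e, n') ∈ t.rules
  | .node a br, [], e, n', s', hn => by
    simp only [List.nil_append, EvTree.HasNode] at hn
    exact ⟨a.1, a.2, by simp [EvTree.HasNode], Branches.mem_rules_of_hasNode_nil br hn⟩
  | .node a br, e₁ :: h, e, n', s', hn => by
    simp only [List.cons_append, EvTree.HasNode] at hn
    obtain ⟨n, s, h1, h2⟩ := Branches.mem_rules_of_hasNode br a.1 hn
    exact ⟨n, s, by simpa [EvTree.HasNode] using h1, h2⟩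
theorem Branches.mem_rules_of_hasNode_nil : ∀ (br : Branches (ℕ × Stack)) {k n' : ℕ} {e : Event}
    {s' : Stack}, br.HasNode e [] (n', s') → (k, e, n') ∈ br.rules k
  | .nil, k, n', e, s', hn => by simp [Branches.HasNode] at hn
  | .cons e' (.node a br') br, k, n', e, s', hn => by
    simp only [Branches.HasNode, EvTree.HasNode] at hn
    rcases hn with ⟨rfl, rfl⟩ | hn
    · simp [Branches.rules, EvTree.loc]
    · simp [Branches.rules, Branches.mem_rules_of_hasNode_nil br hn]
theorem Branches.mem_rules_of_hasNode : ∀ (br : Branches (ℕ × Stack)) (k : ℕ) {e₁ : Event}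
    {h : Trace} {e : Event} {n' : ℕ} {s' : Stack}, br.HasNode e₁ (h ++ [e]) (n', s') →
      ∃ n s, br.HasNode e₁ h (n, s) ∧ (n, e, n') ∈ br.rules k
  | .nil, k, e₁, h, e, n', s', hn => by simp [Branches.HasNode] at hn
  | .cons e' t br, k, e₁, h, e, n', s', hn => by
    simp only [Branches.HasNode] at hn
    rcases hn with ⟨rfl, hn⟩ | hn
    · obtain ⟨n, s, h1, h2⟩ := EvTree.mem_rules_of_hasNode t hn
      exact ⟨n, s, by simp [Branches.HasNode, h1], by simp [Branches.rules, h2]⟩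
    · obtain ⟨n, s, h1, h2⟩ := Branches.mem_rules_of_hasNode br k hn
      exact ⟨n, s, by simp [Branches.HasNode, h1], by simp [Branches.rules, h2]⟩
end

/-! # The rules of a compartment -/

/-- The rules generated for the compartment `C` from the traces `L`. -/
def rulesOf (C : Comp) (L : List Trace) : List Rule := passD (passC (passB (passA C L)))

/-- The node of the call-return tree of `C` reached by the local history `h` has number `n`. -/
def LocOf (C : Comp) (L : List Trace) (h : Trace) (n : ℕ) : Prop :=
  (passB (passA C L)).HasNode h n

section
variable {C : Comp} {L : List Trace} {h h' : Trace} {n n' : ℕ} {e : Event}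

theorem locOf_nil : LocOf C L [] 0 := by
  unfold LocOf passB
  cases passA C L
  simp [EvTree.number, EvTree.HasNode]

theorem exists_locOf_iff : (∃ n, LocOf C L h n) ↔ h = [] ∨ ∃ m ∈ L, h <+: proj C m := by
  unfold LocOf passB passA
  simp [EvTree.hasNode_number, hasNode_treeOfTraces]

theorem LocOf.unique (hn : LocOf C L h n) (hn' : LocOf C L h n') : n = n' :=
  EvTree.HasNode.unique _ (EvTree.distinct_number _ _ (distinct_treeOfTraces _)) hn hn'

theorem LocOf.injective (hn : LocOf C L h n) (hn' : LocOf C L h' n) : h = h' :=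
  EvTree.number_injective _ _ _ _ _ hn hn'

theorem exists_locOf_of_mem_rulesOf (hr : (n, e, n') ∈ rulesOf C L) :
    ∃ h, LocOf C L h n ∧ LocOf C L (h ++ [e]) n' := by
  obtain ⟨h, s, s', h1, h2⟩ := EvTree.hasNode_of_mem_rules _ hr
  exact ⟨h, (EvTree.hasNode_addStack _ _ _ _).1 ⟨s, h1⟩,
    (EvTree.hasNode_addStack _ _ _ _).1 ⟨s', h2⟩⟩

theorem LocOf.mem_rulesOf (hn : LocOf C L h n) (hn' : LocOf C L (h ++ [e]) n') :
    (n, e, n') ∈ rulesOf C L := by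
  obtain ⟨s', h2⟩ := (EvTree.hasNode_addStack _ [] _ _).2 hn'
  obtain ⟨k, s, h1, hr⟩ := EvTree.mem_rules_of_hasNode _ h2
  rwa [hn.unique ((EvTree.hasNode_addStack _ _ _ _).1 ⟨s, h1⟩)]

/-- Tree nodes are prefixes of projections, so each rule is witnessed by an actual occurrence of its
event in a trace. This lets the well-formedness conditions, which speak of traces, apply to rules.
-/
theorem exists_prefix_of_mem_rulesOf (hr : (n, e, n') ∈ rulesOf C L) :
    ∃ h t, (LocOf C L h n ∧ LocOf C L (h ++ [e]) n') ∧ ∃ m ∈ L, proj C m = h ++ e :: t := by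
  obtain ⟨h, h1, h2⟩ := exists_locOf_of_mem_rulesOf hr
  rcases exists_locOf_iff.1 ⟨_, h2⟩ with h3 | ⟨m, hm, t, ht⟩
  · simp at h3
  · exact ⟨h, t, ⟨h1, h2⟩, m, hm, by simp [← ht]⟩

end

/-! # Local histories -/

/-- Every return matches the topmost pending call. -/
def Balanced : Stack → Trace → Prop
  | _, [] => True
  | st, .call A B _ :: m => Balanced ((A, B) :: st) m
  | st, .ret A B _ :: m => ∃ st', st = (B, A) :: st' ∧ Balanced st' m

/-- A call and its matching return involve the same two compartments, so both are kept or both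
dropped, and filtering the stack commutes with push and pop. The passing of control is not retained,
since the projection omits events between other compartments. -/
theorem WellBracketed.balanced_proj (C : Comp) : ∀ (m : Trace) {cur : Comp} {st : Stack},
    WellBracketed cur st m →
      Balanced (st.filter fun p => decide (p.1 = C ∨ p.2 = C)) (proj C m)
  | [], _, _, _ => by simp [proj, Balanced]
  | .call A B z :: m, cur, st, h => by
    obtain ⟨rfl, -, h⟩ := h
    have ih := WellBracketed.balanced_proj C m h
    by_cases hc : A = C ∨ B = C
    · simpa [proj, Event.src, Event.dst, hc, Balanced] using ih
    · simpa [proj, Event.src, Event.dst, hc] using ih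
  | .ret A B z :: m, cur, st, h => by
    obtain ⟨rfl, st', rfl, h⟩ := h
    have ih := WellBracketed.balanced_proj C m h
    by_cases hc : A = C ∨ B = C
    · simpa [proj, Event.src, Event.dst, hc, hc.symm, Balanced] using ih
    · have hc' : ¬(B = C ∨ A = C) := fun h => hc h.symm
      simpa [proj, Event.src, Event.dst, hc, hc'] using ih

/-- The common history produces the same stack, and its top entry names the callee that must return.
This replaces, for returns, what `input_det` provides for calls. -/
theorem Balanced.ret_src_unique : ∀ (h : Trace) {st : Stack} {A₁ A₂ C : Comp} {z₁ z₂ : ℤ}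
    {t₁ t₂ : Trace}, Balanced st (h ++ .ret A₁ C z₁ :: t₁) →
      Balanced st (h ++ .ret A₂ C z₂ :: t₂) → A₁ = A₂
  | [], st, A₁, A₂, C, z₁, z₂, t₁, t₂, h1, h2 => by
    obtain ⟨st₁, rfl, -⟩ := h1
    obtain ⟨st₂, h2, -⟩ := h2
    simp only [List.cons.injEq, Prod.mk.injEq] at h2
    exact h2.1.2
  | .call A B z :: h, st, A₁, A₂, C, z₁, z₂, t₁, t₂, h1, h2 =>
    Balanced.ret_src_unique h (st := (A, B) :: st) h1 h2
  | .ret A B z :: h, st, A₁, A₂, C, z₁, z₂, t₁, t₂, h1, h2 => by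
    obtain ⟨st₁, rfl, h1⟩ := h1
    obtain ⟨st₂, h3, h2⟩ := h2
    simp only [List.cons.injEq, true_and] at h3
    subst h3
    exact Balanced.ret_src_unique h h1 h2

/-- A trace cannot begin, for the compartment that has control first, with an incoming call. -/
theorem WellBracketed.proj_main_ne {main A : Comp} {m t : Trace} {z : ℤ}
    (h : WellBracketed main [] m) : proj main m ≠ .call A main z :: t := by
  intro hp
  match m, h with
  | [], _ => simp [proj] at hp
  | .call C D w :: m, h =>
    obtain ⟨rfl, hne, -⟩ := h
    simp [proj, Event.src] at hp
    exact hne hp.1.2.1.symm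
  | .ret C D w :: m, h =>
    obtain ⟨-, st', h, -⟩ := h
    simp at h

/-- What the generation of the code of `C` from the traces `L` relies on. -/
structure LocallyDeterministic (main C : Comp) (L : List Trace) : Prop where
  bracketed : ∀ m ∈ L, WellBracketed main [] m
  det : ∀ m₁ ∈ L, ∀ m₂ ∈ L, ∀ (h t₁ t₂ : Trace) (e₁ e₂ : Event),
    proj C m₁ = h ++ e₁ :: t₁ → proj C m₂ = h ++ e₂ :: t₂ → e₁.src = C → e₁ = e₂
  input_det : ∀ m₁ ∈ L, ∀ m₂ ∈ L, ∀ (h t₁ t₂ : Trace) (D₁ D₂ : Comp) (z : ℤ),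
    proj C m₁ = h ++ .call D₁ C z :: t₁ → proj C m₂ = h ++ .call D₂ C z :: t₂ → D₁ = D₂

theorem WellFormed.locallyDeterministic {ctxt prog : Finset Comp} {main C : Comp} {S : List Trace}
    (hS : WellFormed ctxt prog main S) (hC : C ∈ ctxt) : LocallyDeterministic main C S :=
  ⟨hS.bracketed, hS.det C hC, hS.input_det C hC⟩

theorem locallyDeterministic_singleton {main C : Comp} {m : Trace}
    (hm : WellBracketed main [] m) : LocallyDeterministic main C [m] := by
  have key : ∀ m₁ ∈ [m], ∀ m₂ ∈ [m], ∀ (h t₁ t₂ : Trace) (e₁ e₂ : Event),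
      proj C m₁ = h ++ e₁ :: t₁ → proj C m₂ = h ++ e₂ :: t₂ → e₁ = e₂ := by
    intro m₁ h₁ m₂ h₂ h t₁ t₂ e₁ e₂ p₁ p₂
    rw [List.mem_singleton] at h₁ h₂
    subst h₁ h₂
    rw [p₁] at p₂
    simp only [List.append_cancel_left_eq, List.cons.injEq] at p₂
    exact p₂.1
  refine ⟨by simpa using hm, fun m₁ h₁ m₂ h₂ h t₁ t₂ e₁ e₂ p₁ p₂ _ =>
    key m₁ h₁ m₂ h₂ h t₁ t₂ e₁ e₂ p₁ p₂, fun m₁ h₁ m₂ h₂ h t₁ t₂ D₁ D₂ z p₁ p₂ => ?_⟩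
  have := key m₁ h₁ m₂ h₂ h t₁ t₂ _ _ p₁ p₂
  simp only [Event.call.injEq] at this
  exact this.1

/-- At location `n`, the rules `rs` of `C` lead along the event `e` to location `n'`, and no other
rule can be chosen by the generated code. -/
structure Follows (C : Comp) (rs : List Rule) (n : ℕ) (e : Event) (n' : ℕ) : Prop where
  mem : (n, e, n') ∈ rs
  outgoing : e.src = C → ∀ e₁ n₁, (n, e₁, n₁) ∈ rs → e₁.src = C → e₁ = e ∧ n₁ = n'
  incoming_call : ∀ A z, e = .call A C z → ∀ A₁ n₁, (n, .call A₁ C z, n₁) ∈ rs → n₁ = n'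
  incoming_ret : ∀ A z, e = .ret A C z → ∀ A₁ n₁, (n, .ret A₁ C z, n₁) ∈ rs → n₁ = n'

/-- A competing rule at `n` comes from a trace with some history numbered `n`; injectivity makes
this history `proj C pre`. The two continuations of the same history are then compared by `det`,
`input_det` or `Balanced.ret_src_unique`, and equal events lead to the same node. -/
theorem LocallyDeterministic.follows {main C : Comp} {L : List Trace} {m pre post : Trace}
    {e : Event} {n : ℕ} (hL : LocallyDeterministic main C L) (hm : m ∈ L)
    (hpre : m = pre ++ e :: post) (he : e.src = C ∨ e.dst = C) (hn : LocOf C L (proj C pre) n) :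
    ∃ n', LocOf C L (proj C (pre ++ [e])) n' ∧ Follows C (rulesOf C L) n e n' := by
  have hm' : proj C m = proj C pre ++ e :: proj C post := by
    simp [hpre, proj, he]
  have hpe : proj C (pre ++ [e]) = proj C pre ++ [e] := by simp [proj, he]
  rw [hpe]
  obtain ⟨n', hn'⟩ : ∃ n', LocOf C L (proj C pre ++ [e]) n' :=
    exists_locOf_iff.2 (Or.inr ⟨m, hm, proj C post, by simp [hm']⟩)
  have hb := (hL.bracketed m hm).balanced_proj C
  rw [hm'] at hb
  refine ⟨n', hn', hn.mem_rulesOf hn', ?_, ?_, ?_⟩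
  · intro hs e₁ n₁ hr _
    obtain ⟨h, t, ⟨hn₁, hn₁'⟩, m₁, hm₁, hp⟩ := exists_prefix_of_mem_rulesOf hr
    obtain rfl := hn.injective hn₁
    obtain rfl := hL.det m hm m₁ hm₁ _ _ _ _ _ hm' hp hs
    exact ⟨rfl, hn₁'.unique hn'⟩
  · rintro A z rfl A₁ n₁ hr
    obtain ⟨h, t, ⟨hn₁, hn₁'⟩, m₁, hm₁, hp⟩ := exists_prefix_of_mem_rulesOf hr
    obtain rfl := hn.injective hn₁
    obtain rfl := hL.input_det m hm m₁ hm₁ _ _ _ _ _ _ hm' hp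
    exact hn₁'.unique hn'
  · rintro A z rfl A₁ n₁ hr
    obtain ⟨h, t, ⟨hn₁, hn₁'⟩, m₁, hm₁, hp⟩ := exists_prefix_of_mem_rulesOf hr
    obtain rfl := hn.injective hn₁
    have hb₁ := (hL.bracketed m₁ hm₁).balanced_proj C
    rw [hp] at hb₁
    obtain rfl := Balanced.ret_src_unique _ hb hb₁
    exact hn₁'.unique hn'

/-- Needed because the run starts with `is_call = 1`, so the main compartment first looks for an
incoming call that never happened. Location `0` is the empty history, and no trace begins for `main`
with such a call. -/
theorem LocallyDeterministic.main_no_incoming_call {main : Comp} {L : List Trace}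
    (hL : LocallyDeterministic main main L) (A : Comp) (z : ℤ) (n : ℕ) :
    (0, .call A main z, n) ∉ rulesOf main L := by
  intro hr
  obtain ⟨h, t, ⟨hn, -⟩, m, hm, hp⟩ := exists_prefix_of_mem_rulesOf hr
  obtain rfl := hn.injective locOf_nil
  exact (hL.bracketed m hm).proj_main_ne hp

/-! # Executions of the generated code -/

theorem Steps.trans {p : Program} {s s' s'' : State} {t t' : Trace} (h : Steps p s t s')
    (h' : Steps p s' t' s'') : Steps p s (t ++ t') s'' := by
  induction h with
  | refl => exact h'
  | step h₁ _ ih => rw [List.append_assoc]; exact .step h₁ (ih h')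

theorem Steps.silent_trans {p : Program} {s s' s'' : State} {t : Trace} (h : Steps p s [] s')
    (h' : Steps p s' t s'') : Steps p s t s'' := h.trans h'

theorem Steps.cons {p : Program} {s s' s'' : State} {t : Trace} (h : Step p s [] s')
    (h' : Steps p s' t s'') : Steps p s t s'' := .step h h'

theorem Steps.single {p : Program} {s s' : State} {t : Trace} (h : Step p s t s') :
    Steps p s t s' := by
  simpa using Steps.step h (.refl s')

/-- A memory of the generated compartments: the variables `loc`, `is_call` and `res`. -/
def varBlock (l c r : ℤ) : List (List Value) := [[.int l, .int c, .int r]]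

section
variable {p : Program} {C : Comp} {s : List Frame} {mem : Memory} {k : Cont} {a : Value}
  {l c r : ℤ}

theorem steps_varAddr {i : ℤ} :
    Steps p ⟨C, s, mem, k, varAddr i, a⟩ [] ⟨C, s, mem, k, .val (.ptr C 0 i), a⟩ := by
  refine .cons .binop₁ (.cons .localBuf (.cons .binop₂ (.cons .binop₃ ?_)))
  simpa [Binop.eval] using Steps.refl _

theorem steps_getVar {i : ℤ} {v : Value} (h : mem.load C 0 i = some v) :
    Steps p ⟨C, s, mem, k, getVar i, a⟩ [] ⟨C, s, mem, k, .val v, a⟩ :=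
  .cons .deref₁ (steps_varAddr.silent_trans (.single (.deref₂ h)))

theorem steps_getVar_loc (h : mem C = varBlock l c r) :
    Steps p ⟨C, s, mem, k, getVar 0, a⟩ [] ⟨C, s, mem, k, .val (.int l), a⟩ :=
  steps_getVar (by simp [Memory.load, h, varBlock])

theorem steps_getVar_isCall (h : mem C = varBlock l c r) :
    Steps p ⟨C, s, mem, k, getVar 1, a⟩ [] ⟨C, s, mem, k, .val (.int c), a⟩ :=
  steps_getVar (by simp [Memory.load, h, varBlock])

theorem steps_getVar_res (h : mem C = varBlock l c r) :
    Steps p ⟨C, s, mem, k, getVar 2, a⟩ [] ⟨C, s, mem, k, .val (.int r), a⟩ :=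
  steps_getVar (by simp [Memory.load, h, varBlock])

theorem steps_store {i : ℤ} {mem' : Memory} {v : Value} (h : mem.store C 0 i v = some mem') :
    Steps p ⟨C, s, mem, .assign₁ (varAddr i) k, .val v, a⟩ [] ⟨C, s, mem', k, .val v, a⟩ :=
  .cons .assign₂ (steps_varAddr.silent_trans (.single (.assign₃ h)))

theorem steps_store_loc {x : ℤ} (h : mem C = varBlock l c r) :
    Steps p ⟨C, s, mem, .assign₁ (varAddr 0) k, .val (.int x), a⟩ []
      ⟨C, s, Function.update mem C (varBlock x c r), k, .val (.int x), a⟩ :=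
  steps_store (by simp [Memory.store, h, varBlock])

theorem steps_store_isCall {x : ℤ} (h : mem C = varBlock l c r) :
    Steps p ⟨C, s, mem, .assign₁ (varAddr 1) k, .val (.int x), a⟩ []
      ⟨C, s, Function.update mem C (varBlock l x r), k, .val (.int x), a⟩ :=
  steps_store (by simp [Memory.store, h, varBlock])

theorem steps_store_res {x : ℤ} (h : mem C = varBlock l c r) :
    Steps p ⟨C, s, mem, .assign₁ (varAddr 2) k, .val (.int x), a⟩ []
      ⟨C, s, Function.update mem C (varBlock l c x), k, .val (.int x), a⟩ :=
  steps_store (by simp [Memory.store, h, varBlock])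

/-- The test for a rule for an incoming event. -/
theorem steps_test {e e₁ e₂ : Expr} {n x z : ℤ} (h : mem C = varBlock l c r)
    (he : ∀ k, Steps p ⟨C, s, mem, k, e, a⟩ [] ⟨C, s, mem, k, .val (.int x), a⟩) :
    Steps p ⟨C, s, mem, k, .ite (.binop .mul (.binop .eq (getVar 0) (intE n))
        (.binop .eq e (intE z))) e₁ e₂, a⟩ []
      ⟨C, s, mem, k, if l = n ∧ x = z then e₁ else e₂, a⟩ := by
  refine .cons .ite₁ (.cons .binop₁ (.cons .binop₁ ((steps_getVar_loc h).silent_trans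
    (.cons .binop₂ (.cons .binop₃ (.cons .binop₂ (.cons .binop₁ ((he _).silent_trans
    (.cons .binop₂ (.cons .binop₃ (.cons .binop₃ (.cons .ite₂ ?_))))))))))))
  -- The product of the two 0/1 tests is their conjunction.
  by_cases h1 : l = n <;> by_cases h2 : x = z <;> simp [h1, h2] <;> exact Steps.refl _

theorem steps_setLoc {x : ℤ} (h : mem C = varBlock l c r) :
    Steps p ⟨C, s, mem, k, setVar 0 (intE x), a⟩ []
      ⟨C, s, Function.update mem C (varBlock x c r), k, .val (.int x), a⟩ :=
  .cons .assign₁ (steps_store_loc h)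

theorem steps_setIsCall {x : ℤ} (h : mem C = varBlock l c r) :
    Steps p ⟨C, s, mem, k, setVar 1 (intE x), a⟩ []
      ⟨C, s, Function.update mem C (varBlock l x r), k, .val (.int x), a⟩ :=
  .cons .assign₁ (steps_store_isCall h)

-- Selection of a rule by the generated conditionals

theorem steps_switchCalls {n n' : ℕ} {z : ℤ} (h : mem C = varBlock n c r) (rs : List Rule)
    (hu : ∀ A x, (n, .call A C z, x) ∈ rs → x = n') (hex : ∃ A, (n, .call A C z, n') ∈ rs) :
    ∃ v, Steps p ⟨C, s, mem, k, switchCalls C rs, .int z⟩ []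
      ⟨C, s, Function.update mem C (varBlock n' c r), k, .val v, .int z⟩ := by
  induction rs with
  | nil => simp at hex
  | cons rule rs ih =>
    have hu' : ∀ A x, (n, .call A C z, x) ∈ rs → x = n' :=
      fun A x hx => hu A x (List.mem_cons_of_mem _ hx)
    rcases rule with ⟨n₁, ⟨A, D, w⟩ | ⟨A, D, w⟩, n₂⟩
    · by_cases hD : D = C
      · subst hD
        simp only [switchCalls, List.foldr_cons, if_true]
        by_cases hc : n = n₁ ∧ z = w
        · obtain ⟨rfl, rfl⟩ := hc
          obtain rfl := hu A n₂ (by simp)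
          refine ⟨.int n₂, (steps_test h fun k => .single .arg).silent_trans ?_⟩
          rw [if_pos ⟨rfl, rfl⟩]
          exact steps_setLoc h
        · obtain ⟨v, hv⟩ := ih hu' (by grind)
          refine ⟨v, (steps_test h fun k => .single .arg).silent_trans ?_⟩
          rw [if_neg (by simpa using hc)]
          exact hv
      · obtain ⟨v, hv⟩ := ih hu' (by grind)
        refine ⟨v, ?_⟩
        simp only [switchCalls, List.foldr_cons, if_neg hD]
        exact hv
    · obtain ⟨v, hv⟩ := ih hu' (by grind)
      exact ⟨v, hv⟩

theorem steps_switchCalls_none {n : ℕ} {z : ℤ} (h : mem C = varBlock n c r) (rs : List Rule)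
    (hu : ∀ A x, (n, .call A C z, x) ∉ rs) :
    ∃ v, Steps p ⟨C, s, mem, k, switchCalls C rs, .int z⟩ [] ⟨C, s, mem, k, .val v, .int z⟩ := by
  induction rs with
  | nil => exact ⟨_, .refl _⟩
  | cons rule rs ih =>
    obtain ⟨v, hv⟩ := ih fun A x hx => hu A x (List.mem_cons_of_mem _ hx)
    rcases rule with ⟨n₁, ⟨A, D, w⟩ | ⟨A, D, w⟩, n₂⟩
    · by_cases hD : D = C
      · subst hD
        simp only [switchCalls, List.foldr_cons, if_true]
        refine ⟨v, (steps_test h fun k => .single .arg).silent_trans ?_⟩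
        rw [if_neg]
        · exact hv
        · rintro ⟨h1, rfl⟩
          rw [Nat.cast_inj] at h1
          exact hu A n₂ (by simp [h1])
      · refine ⟨v, ?_⟩
        simp only [switchCalls, List.foldr_cons, if_neg hD]
        exact hv
    · exact ⟨v, hv⟩

theorem steps_switchReturns {n n' : ℕ} {z : ℤ} (h : mem C = varBlock n c z) (rs : List Rule)
    (hu : ∀ A x, (n, .ret A C z, x) ∈ rs → x = n') (hex : ∃ A, (n, .ret A C z, n') ∈ rs) :
    ∃ v, Steps p ⟨C, s, mem, k, switchReturns C rs, a⟩ []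
      ⟨C, s, Function.update mem C (varBlock n' c z), k, .val v, a⟩ := by
  induction rs with
  | nil => simp at hex
  | cons rule rs ih =>
    have hu' : ∀ A x, (n, .ret A C z, x) ∈ rs → x = n' :=
      fun A x hx => hu A x (List.mem_cons_of_mem _ hx)
    rcases rule with ⟨n₁, ⟨A, D, w⟩ | ⟨A, D, w⟩, n₂⟩
    · obtain ⟨v, hv⟩ := ih hu' (by grind)
      exact ⟨v, hv⟩
    · by_cases hD : D = C
      · subst hD
        simp only [switchReturns, List.foldr_cons, if_true]
        by_cases hc : n = n₁ ∧ z = w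
        · obtain ⟨rfl, rfl⟩ := hc
          obtain rfl := hu A n₂ (by simp)
          refine ⟨.int n₂, (steps_test h fun k => steps_getVar_res h).silent_trans ?_⟩
          rw [if_pos ⟨rfl, rfl⟩]
          exact steps_setLoc h
        · obtain ⟨v, hv⟩ := ih hu' (by grind)
          refine ⟨v, (steps_test h fun k => steps_getVar_res h).silent_trans ?_⟩
          rw [if_neg (by simpa using hc)]
          exact hv
      · obtain ⟨v, hv⟩ := ih hu' (by grind)
        refine ⟨v, ?_⟩
        simp only [switchReturns, List.foldr_cons, if_neg hD]
        exact hv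

/-- Any applicable rule has the right event and target, so the first one found does too; rules that
fail a test are skipped by induction. -/
theorem steps_switchOutgoing {n n' : ℕ} {e : Event} (h : mem C = varBlock n c r)
    (rs : List Rule) (hu : ∀ e₁ n₁, (n, e₁, n₁) ∈ rs → e₁.src = C → e₁ = e ∧ n₁ = n')
    (hex : (n, e, n') ∈ rs) (he : e.src = C) :
    Steps p ⟨C, s, mem, k, switchOutgoing C rs, a⟩ [] ⟨C, s, mem, k, emit C n' e, a⟩ := by
  induction rs with
  | nil => simp at hex
  | cons rule rs ih =>
    have hu' : ∀ e₁ n₁, (n, e₁, n₁) ∈ rs → e₁.src = C → e₁ = e ∧ n₁ = n' :=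
      fun A x hx => hu A x (List.mem_cons_of_mem _ hx)
    rcases rule with ⟨n₁, e₁, n₂⟩
    by_cases hs : e₁.src = C
    · simp only [switchOutgoing, List.foldr_cons, if_pos hs]
      refine .cons .ite₁ (.cons .binop₁ ((steps_getVar_loc h).silent_trans
        (.cons .binop₂ (.cons .binop₃ (.cons .ite₂ ?_)))))
      by_cases hc : n = n₁
      · subst hc
        obtain ⟨rfl, rfl⟩ := hu e₁ n₂ (by simp) hs
        simpa using Steps.refl _
      · have := ih hu' (by grind)
        simpa [hc, switchOutgoing] using this
    · have := ih hu' (by grind)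
      simp only [switchOutgoing, List.foldr_cons, if_neg hs]
      exact this

/-- What remains to be done by a generated compartment when a call returns to it. -/
def resume (C : Comp) : Cont :=
  .assign₁ (varAddr 2) (.seq (.seq (setVar 1 (intE 0)) (.call C (intE 0))) .halt)

theorem steps_emit_call {n' : ℕ} {D : Comp} {z : ℤ} {d : Compartment} (h : mem C = varBlock l c r)
    (hne : C ≠ D) (hd : p.code D = some d) :
    Steps p ⟨C, s, mem, .halt, emit C n' (.call C D z), a⟩ [.call C D z]
      ⟨D, ⟨C, a, resume C⟩ :: s, Function.update mem C (varBlock n' 1 r), .halt, d.body,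
        .int z⟩ := by
  refine .cons .seq₁ ((steps_setIsCall h).silent_trans (.cons .seq₂ (.cons .seq₁
    ((steps_setLoc (Function.update_self _ _ _)).silent_trans (.cons .seq₂ (.cons .seq₁
    (.cons .assign₁ (.cons .call ?_))))))))
  rw [Function.update_idem]
  exact .single (.externalCall hne hd)

/-- Silent: the return event occurs only after the frames of self-calls have been unwound, in
`StackMatch.steps_ret`. -/
theorem steps_emit_ret {n' : ℕ} {A D : Comp} {z : ℤ} (h : mem C = varBlock l c r) :
    Steps p ⟨C, s, mem, k, emit C n' (.ret A D z), a⟩ []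
      ⟨C, s, Function.update mem C (varBlock n' 1 r), k, .val (.int z), a⟩ := by
  refine .cons .seq₁ ((steps_setIsCall h).silent_trans (.cons .seq₂ (.cons .seq₁
    ((steps_setLoc (Function.update_self _ _ _)).silent_trans (.cons .seq₂ ?_)))))
  rw [Function.update_idem]
  exact .refl _

end

-- Simulation invariant and induction along the trace

/-- The concrete stack `fs`, when `C` has control, represents the abstract stack `st`: it has in
addition frames for the calls of compartments to themselves. -/
inductive StackMatch : Comp → Stack → List Frame → Prop
  | nil {C} : StackMatch C [] []
  | internal {C st fs a} (h : StackMatch C st fs) : StackMatch C st (⟨C, a, .halt⟩ :: fs)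
  | external {C D st fs a} (hne : C ≠ D) (h : StackMatch D st fs) :
      StackMatch C ((D, C) :: st) (⟨D, a, resume D⟩ :: fs)

/-- Self-call frames have continuation `halt`, so the value passes through them by internal returns
until the frame of the external caller is on top. -/
theorem StackMatch.steps_ret {p : Program} {C D : Comp} {st st' : Stack} {fs : List Frame}
    (h : StackMatch C st fs) (hst : st = (D, C) :: st') {mem : Memory} {a : Value} {z : ℤ} :
    ∃ fs' a', StackMatch D st' fs' ∧ Steps p ⟨C, fs, mem, .halt, .val (.int z), a⟩ [.ret C D z]
      ⟨D, fs', mem, resume D, .val (.int z), a'⟩ := by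
  induction h generalizing a with
  | nil => simp at hst
  | internal _ ih =>
    obtain ⟨fs', a', h1, h2⟩ := ih hst (a := _)
    exact ⟨fs', a', h1, .cons .internalReturn h2⟩
  | external hne h =>
    simp only [List.cons.injEq, Prod.mk.injEq] at hst
    obtain ⟨⟨rfl, -⟩, rfl⟩ := hst
    exact ⟨_, _, h, .single (.externalReturn hne)⟩

/-- The variables of all compartments of `dom` after the trace `pre`, when `cur` has control. -/
def MemMatch (dom : Finset Comp) (L : Comp → List Trace) (cur : Comp) (pre : Trace)
    (mem : Memory) : Prop :=
  ∀ C ∈ dom, ∃ (n : ℕ) (c r : ℤ), mem C = varBlock n c r ∧ LocOf C (L C) (proj C pre) n ∧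
    (C ≠ cur → c = 1)

/-- The variables while control passes along `e`: the receiver has not updated its location. -/
theorem MemMatch.transfer {dom : Finset Comp} {L : Comp → List Trace} {A B : Comp} {pre : Trace}
    {mem : Memory} {e : Event} (h : MemMatch dom L A pre mem) (hA : e.src = A) (hB : e.dst = B)
    {n₁ n₂ : ℕ} {r₁ c₂ r₂ : ℤ} (hn₁ : LocOf A (L A) (proj A (pre ++ [e])) n₁)
    (hn₂ : LocOf B (L B) (proj B (pre ++ [e])) n₂) (hne : A ≠ B) :
    MemMatch dom L B (pre ++ [e]) (Function.update
      (Function.update mem A (varBlock n₁ 1 r₁)) B (varBlock n₂ c₂ r₂)) := by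
  intro C hC
  by_cases h2 : C = B
  · subst h2
    exact ⟨n₂, c₂, r₂, by simp, hn₂, by simp⟩
  by_cases h1 : C = A
  · subst h1
    exact ⟨n₁, 1, r₁, by simp [hne], hn₁, by simp⟩
  · obtain ⟨n, c, r, hm, hn, hc⟩ := h C hC
    refine ⟨n, c, r, by simp [h1, h2, hm], ?_, fun _ => hc h1⟩
    simpa [proj, hA, hB, Ne.symm h1, Ne.symm h2] using hn

/-- The generating list `L C` may vary with the compartment, which treats context and program
uniformly. One induction step runs from one outgoing selection to the next: emit, pass control, let
the receiver update its location. -/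
theorem steps_trace {p : Program} {dom : Finset Comp} {L : Comp → List Trace} {main : Comp}
    {m : Trace} (hcode : ∀ C ∈ dom, p.code C = some (passE C (rulesOf C (L C))))
    (hL : ∀ C ∈ dom, LocallyDeterministic main C (L C)) (hm : ∀ C ∈ dom, m ∈ L C)
    (hdom : ∀ e ∈ m, e.src ∈ dom ∧ e.dst ∈ dom) (rest : Trace) :
    ∀ (pre : Trace), m = pre ++ rest → ∀ (C : Comp) (st : Stack), WellBracketed C st rest →
      ∀ (fs : List Frame) (mem : Memory) (a : Value), StackMatch C st fs → MemMatch dom L C pre mem →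
      ∃ s', Steps p ⟨C, fs, mem, .halt, switchOutgoing C (rulesOf C (L C)), a⟩ rest s' := by
  induction rest with
  | nil => exact fun _ _ _ _ _ _ _ _ _ _ => ⟨_, .refl _⟩
  | cons e rest ih =>
    intro pre hpre C st hw fs mem a hst hmem
    have hsrc : e.src ∈ dom := (hdom e (by simp [hpre])).1
    have hdst : e.dst ∈ dom := (hdom e (by simp [hpre])).2
    obtain ⟨n₁, c₁, r₁, hm₁, hn₁, -⟩ := hmem e.src (by assumption)
    obtain ⟨n₂, c₂, r₂, hm₂, hn₂, hc₂⟩ := hmem e.dst (by assumption)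
    obtain ⟨n₁', hn₁', hf₁⟩ := (hL _ hsrc).follows (hm _ hsrc) hpre (Or.inl rfl) hn₁
    obtain ⟨n₂', hn₂', hf₂⟩ := (hL _ hdst).follows (hm _ hdst) hpre (Or.inr rfl) hn₂
    cases e with
    | call A D z =>
      obtain ⟨rfl, hne, hw⟩ := hw
      simp only [Event.src, Event.dst] at *
      -- The callee does not have control, so its `is_call` is `1` and it will consult its call
      -- rules.
      obtain rfl := hc₂ hne.symm
      have hm₂' : Function.update mem A (varBlock n₁' 1 r₁) D = varBlock n₂ 1 r₂ := by
        rw [Function.update_of_ne hne.symm, hm₂]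
      obtain ⟨s', hs'⟩ := ih (pre ++ [Event.call A D z]) (by simp [hpre]) D _ hw
        (⟨A, a, resume A⟩ :: fs) _ (.int z) (.external hne.symm hst)
        (hmem.transfer rfl rfl (r₁ := r₁) (c₂ := 1) (r₂ := r₂) hn₁' hn₂' hne)
      obtain ⟨v, hv⟩ := steps_switchCalls (p := p) (s := ⟨A, a, resume A⟩ :: fs)
        (k := .seq (switchOutgoing D (rulesOf D (L D))) .halt) hm₂' _
        (hf₂.incoming_call A z rfl) ⟨A, hf₂.mem⟩
      refine ⟨s', (steps_switchOutgoing hm₁ _ (hf₁.outgoing rfl) hf₁.mem rfl).silent_trans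
        ((steps_emit_call hm₁ hne (hcode D hdst)).trans (t' := rest) ?_)⟩
      refine .cons .seq₁ (.cons .ite₁ ((steps_getVar_isCall hm₂').silent_trans
        (.cons .ite₂ ?_)))
      rw [if_pos one_ne_zero]
      exact hv.silent_trans (.cons .seq₂ hs')
    | ret A D z =>
      obtain ⟨rfl, st', rfl, hw⟩ := hw
      simp only [Event.src, Event.dst] at *
      -- For returns, `WellBracketed` does not state distinctness; it comes from the external frame
      -- that matches the top of the abstract stack.
      have hne : A ≠ D := by
        clear * - hst
        generalize h : (D, A) :: st' = st at hst
        induction hst with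
        | nil => simp at h
        | internal _ ih => exact ih h
        | external hne =>
          simp only [List.cons.injEq, Prod.mk.injEq] at h
          obtain ⟨⟨rfl, -⟩, -⟩ := h
          exact hne
      have hm₂' : Function.update mem A (varBlock n₁' 1 r₁) D = varBlock n₂ c₂ r₂ := by
        rw [Function.update_of_ne hne.symm, hm₂]
      obtain ⟨fs', a', hst', hret⟩ := hst.steps_ret (p := p) rfl
        (mem := Function.update mem A (varBlock n₁' 1 r₁)) (a := a) (z := z)
      -- The next selection happens inside the self-call of `D`, with argument `0` and one more
      -- internal frame; by then `D` has stored `z` in `res` and cleared `is_call`, as the invariant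
      -- allows for the compartment in control.
      obtain ⟨s', hs'⟩ := ih (pre ++ [Event.ret A D z]) (by simp [hpre]) D _ hw
        (⟨D, a', .halt⟩ :: fs') _ (.int 0) (.internal hst')
        (hmem.transfer rfl rfl (r₁ := r₁) (c₂ := 0) (r₂ := z) hn₁' hn₂' hne)
      obtain ⟨v, hv⟩ := steps_switchReturns (p := p) (s := ⟨D, a', .halt⟩ :: fs') (a := .int 0)
        (mem := Function.update (Function.update mem A (varBlock n₁' 1 r₁)) D (varBlock n₂ 0 z))
        (k := .seq (switchOutgoing D (rulesOf D (L D))) .halt) (Function.update_self _ _ _) _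
        (hf₂.incoming_ret A z rfl) ⟨A, hf₂.mem⟩
      rw [Function.update_idem] at hv
      refine ⟨s', (steps_switchOutgoing hm₁ _ (hf₁.outgoing rfl) hf₁.mem rfl).silent_trans
        ((steps_emit_ret hm₁).silent_trans (hret.trans (t' := rest) ?_))⟩
      refine (steps_store_res hm₂').silent_trans (.cons .seq₂ (.cons .seq₁
        ((steps_setIsCall (Function.update_self _ _ _)).silent_trans (.cons .seq₂ (.cons .call
        (.cons (.internalCall (hcode D hdst)) (.cons .seq₁ (.cons .ite₁ ?_))))))))
      rw [Function.update_idem]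
      refine (steps_getVar_isCall (Function.update_self _ _ _)).silent_trans (.cons .ite₂ ?_)
      -- Here `is_call` is `0`, so the return rules are consulted.
      rw [if_neg (by simp)]
      exact hv.silent_trans (.cons .seq₂ hs')

theorem produces_of_locallyDeterministic {p : Program} {dom : Finset Comp}
    {L : Comp → List Trace} {main : Comp} {m : Trace} (hmain : main ∈ dom)
    (hcode : ∀ C ∈ dom, p.code C = some (passE C (rulesOf C (L C))))
    (hL : ∀ C ∈ dom, LocallyDeterministic main C (L C)) (hm : ∀ C ∈ dom, m ∈ L C)
    (hdom : ∀ e ∈ m, e.src ∈ dom ∧ e.dst ∈ dom) : Produces p main m := by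
  have hinit : ∀ C ∈ dom, p.initMem C = varBlock (0 : ℕ) 1 0 := fun C hC => by
    simp [Program.initMem, hcode C hC, passE, varBlock]
  obtain ⟨s', hs'⟩ := steps_trace hcode hL hm hdom m [] rfl main []
    ((hL main hmain).bracketed m (hm main hmain)) [] p.initMem (.int 0) .nil
    fun C hC => ⟨0, 1, 0, hinit C hC, locOf_nil, fun _ => rfl⟩
  obtain ⟨v, hv⟩ := steps_switchCalls_none (p := p) (s := []) (z := 0)
    (k := .seq (switchOutgoing main (rulesOf main (L main))) .halt) (hinit main hmain)
    (rulesOf main (L main)) fun A x => (hL main hmain).main_no_incoming_call A 0 x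
  refine ⟨_, s', .intro (hcode main hmain), .cons .seq₁ (.cons .ite₁
    ((steps_getVar_isCall (hinit main hmain)).silent_trans (.cons .ite₂ ?_)))⟩
  rw [if_pos one_ne_zero]
  exact hv.silent_trans (.cons .seq₂ hs')

/-! # Calls of the generated code -/

theorem callees_switchCalls (C : Comp) (rs : List Rule) : (switchCalls C rs).callees = ∅ := by
  induction rs with
  | nil => rfl
  | cons rule rs ih =>
    rcases rule with ⟨n₁, ⟨A, D, w⟩ | ⟨A, D, w⟩, n₂⟩
    · by_cases hD : D = C
      · simp only [switchCalls, List.foldr_cons, if_pos hD] at ih ⊢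
        simp [Expr.callees, getVar, setVar, varAddr, intE] at ih ⊢
        exact ih
      · simp only [switchCalls, List.foldr_cons, if_neg hD] at ih ⊢
        exact ih
    · exact ih

theorem callees_switchReturns (C : Comp) (rs : List Rule) :
    (switchReturns C rs).callees = ∅ := by
  induction rs with
  | nil => rfl
  | cons rule rs ih =>
    rcases rule with ⟨n₁, ⟨A, D, w⟩ | ⟨A, D, w⟩, n₂⟩
    · exact ih
    · by_cases hD : D = C
      · simp only [switchReturns, List.foldr_cons, if_pos hD] at ih ⊢
        simp [Expr.callees, getVar, setVar, varAddr, intE] at ih ⊢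
        exact ih
      · simp only [switchReturns, List.foldr_cons, if_neg hD] at ih ⊢
        exact ih

theorem callees_emit (C : Comp) (n : ℕ) (e : Event) :
    (emit C n e).callees ⊆ {C, e.dst} := by
  cases e <;> simp [emit, Expr.callees, setVar, varAddr, intE, Event.dst, Set.pair_comm]

theorem callees_switchOutgoing (C : Comp) (rs : List Rule) {D : Comp}
    (h : D ∈ (switchOutgoing C rs).callees) : D = C ∨ ∃ r ∈ rs, r.2.1.dst = D := by
  induction rs with
  | nil => simp [switchOutgoing, Expr.callees] at h
  | cons rule rs ih =>
    by_cases hs : rule.2.1.src = C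
    · simp only [switchOutgoing, List.foldr_cons, if_pos hs] at h ih
      simp only [Expr.callees, getVar, varAddr, intE, Set.union_self, Set.empty_union,
        Set.mem_union] at h
      rcases h with h | h
      · rcases callees_emit _ _ _ h with h | h
        · exact Or.inl h
        · exact Or.inr ⟨rule, by simp, h.symm⟩
      · exact (ih h).imp_right fun ⟨r, hr, h⟩ => ⟨r, List.mem_cons_of_mem _ hr, h⟩
    · simp only [switchOutgoing, List.foldr_cons, if_neg hs] at h ih
      exact (ih h).imp_right fun ⟨r, hr, h⟩ => ⟨r, List.mem_cons_of_mem _ hr, h⟩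

/-- The only calls in the code come from `emit`: the self-call and the destination of a call event,
which lies in some trace since every rule does. -/
theorem callees_passE {C D : Comp} {L : List Trace}
    (h : D ∈ (passE C (rulesOf C L)).body.callees) :
    D = C ∨ ∃ m ∈ L, ∃ e ∈ m, e.dst = D := by
  simp only [passE, Expr.callees, callees_switchCalls, callees_switchReturns, getVar, varAddr,
    intE, Set.union_self, Set.empty_union] at h
  refine (callees_switchOutgoing _ _ h).imp_right ?_
  rintro ⟨⟨n, e, n'⟩, hr, h⟩
  obtain ⟨pre, t, -, m, hm, hp⟩ := exists_prefix_of_mem_rulesOf hr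
  have he : e ∈ proj C m := by simp [hp]
  exact ⟨m, hm, e, (List.mem_filter.1 he).1, h⟩

/-- The traces from which the compartment `C` is generated. -/
def sourceTraces (ctxt : Finset Comp) (S : List Trace) (m : Trace) (C : Comp) : List Trace :=
  if C ∈ ctxt then S else [m]

theorem backTranslateWhole_code (ctxt prog : Finset Comp) (S : List Trace) (m : Trace)
    (C : Comp) : (backTranslateWhole ctxt prog S m).code C =
      if C ∈ ctxt ∪ prog then some (passE C (rulesOf C (sourceTraces ctxt S m C))) else none := by
  by_cases h₁ : C ∈ ctxt <;> by_cases h₂ : C ∈ prog <;>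
    simp [backTranslateWhole, Program.link, backTranslate, sourceTraces, rulesOf, h₁, h₂]

end BackTranslation

-- Linking context and program

theorem theorem1 (ctxt prog : Finset Comp) (hdisj : Disjoint ctxt prog)
    (main : Comp) (hmain : main ∈ ctxt ∪ prog)
    (S : List Trace) (hS : WellFormed ctxt prog main S) :
    ∀ m ∈ S, (backTranslateWhole ctxt prog S m).IsWhole main ∧
      Produces (backTranslateWhole ctxt prog S m) main m := by
  intro m hm
  have hcode : ∀ C ∈ ctxt ∪ prog, (backTranslateWhole ctxt prog S m).code C =
      some (passE C (rulesOf C (sourceTraces ctxt S m C))) := fun C hC => by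
    rw [backTranslateWhole_code, if_pos hC]
  have hsub : ∀ C, ∀ m' ∈ sourceTraces ctxt S m C, m' ∈ S := by
    intro C m' h
    unfold sourceTraces at h
    split_ifs at h
    · exact h
    · rwa [List.mem_singleton.1 h]
  refine ⟨⟨by simp [hcode main hmain], fun C d hd D hD => ?_⟩,
    produces_of_locallyDeterministic hmain hcode (fun C _ => ?_) (fun C _ => ?_)
      (hS.compartments m hm)⟩
  · rw [backTranslateWhole_code] at hd
    split_ifs at hd with hC
    obtain rfl := Option.some.inj hd
    -- Callees stay in the domain because the events of every trace of `S` do.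
    have hD' : D ∈ ctxt ∪ prog := by
      rcases callees_passE hD with rfl | ⟨m', hm', e, he, rfl⟩
      · exact hC
      · exact (hS.compartments m' (hsub C m' hm') e he).2
    simp [hcode D hD']
  · unfold sourceTraces
    split_ifs with h
    · exact hS.locallyDeterministic h
    · exact locallyDeterministic_singleton (hS.bracketed m hm)
  · unfold sourceTraces
    split_ifs
    · exact hm
    · exact List.mem_singleton_self m
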